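/- Let $s\in\{\tfrac12,1,\tfrac32,\dots\}$ be a spin quantum number and $N\ge 1$. Let $\mathcal H$ be the Hilbert space of $N$ spins $s$, i.e. the $N$-fold tensor power of $\mathbb C^{2s+1}$, where $\mathbb C^{2s+1}$ has the orthonormal basis $|m\rangle$, $m=s,s-1,\dots,-s$. Let $\mathcal S=(\mathbb S^2)^N$ be the classical phase space, with the measure $$\widetilde d\Omega=\Big(\frac{2s+1}{4\pi}\Big)^{N}\,d\Omega_1\cdots d\Omega_N ,$$ where $d\Omega_\mu$ is the surface measure of the unit sphere $\mathbb S^2\subset\mathbb R^3$. For $\Omega\in\mathbb S^2$ with polar angle $\theta\in[0,\pi]$ and azimuth $\phi$ (set $\phi=0$ at the poles) let $$|\Omega\rangle=\sum_{m=-s}^{s}\binom{2s}{s+m}^{1/2}\Big(\cos\frac\theta2\Big)^{s+m}\Big(\sin\frac\theta2\Big)^{s-m}e^{i(s-m)\phi}\,|m\rangle$$ be the spin coherent state, and for $\Omega=(\Omega_1,\dots,\Omega_N)\in\mathcal S$ let $|\Omega\rangle=|\Omega_1\rangle\otimes\cdots\otimes|\Omega_N\rangle\in\mathcal H$. For a real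 function $F\in L^\infty(\mathcal S,\widetilde d\Omega)$ define its contravariant matrix, a Hermitian operator on $\mathcal H$, by $$A(F)=\int_{\mathcal S}F(\Omega)\,|\Omega\rangle\langle\Omega|\,\widetilde d\Omega .$$ Then the map $F\mapsto A(F)$, from the real space $L^\infty(\mathcal S,\widetilde d\Omega)$ to the real space $B_h(\mathcal H)$ of Hermitian operators on $\mathcal H$, is surjective: for every Hermitian operator $B$ on $\mathcal H$ there is a real $F\in L^\infty(\mathcal S,\widetilde d\Omega)$ with $A(F)=B$. -/

import Mathlib

open MeasureTheory
open scoped ENNReal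

/-! The spin quantum number is `s = n / 2` with `n : ℕ`; the basis vector `|m⟩` of the single spin
space, `m = s, s - 1, …, -s`, is labelled by `k = s - m : Fin (n + 1)`. -/

noncomputable section

namespace SpinCoherent

/-- The unit sphere in three-dimensional Euclidean space: the phase space of a single spin. -/
abbrev Sphere2 : Type := Metric.sphere (0 : EuclideanSpace ℝ (Fin 3)) 1

/-- The classical phase space of `N` spins. -/
abbrev PhaseSpace (N : ℕ) : Type := Fin N → Sphere2

/-- The Hilbert space of a single spin `s = n / 2`, with the orthonormal eigenbasis `|m⟩` of the
third spin operator as its standard basis. -/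
abbrev SpinSpace (n : ℕ) : Type := EuclideanSpace ℂ (Fin (n + 1))

/-- The Hilbert space of `N` spins: the `N`-fold tensor power of the single spin space, written in
the orthonormal product basis `|m₁, …, m_N⟩ = |m₁⟩ ⊗ … ⊗ |m_N⟩`. -/
abbrev HilbertSpace (N n : ℕ) : Type := EuclideanSpace ℂ (Fin N → Fin (n + 1))

/-- The pure tensor `v₁ ⊗ … ⊗ v_N`, in the product basis. -/
def pureTensor {N n : ℕ} (v : Fin N → SpinSpace n) : HilbertSpace N n :=
  WithLp.toLp 2 fun m => ∏ i, v i (m i)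

/-- The polar angle `θ ∈ [0, π]` of a point of the sphere. -/
def polar (Ω : Sphere2) : ℝ := Real.arccos (Ω.1 2)

/-- The azimuthal angle of a point of the sphere, modulo `2π` (with value `0` at the poles). -/
def azimuth (Ω : Sphere2) : ℝ := Complex.arg (⟨Ω.1 0, Ω.1 1⟩ : ℂ)

/-- The single spin coherent state
`|Ω⟩ = ∑ₘ √(2s choose s+m) (cos θ/2)^(s+m) (sin θ/2)^(s-m) e^{i(s-m)φ} |m⟩`,
where `2s = n`, `s - m = k` and `s + m = n - k`. -/
def coherent (n : ℕ) (Ω : Sphere2) : SpinSpace n :=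
  WithLp.toLp 2 fun k : Fin (n + 1) =>
    ((Real.sqrt (n.choose (n - k)) * Real.cos (polar Ω / 2) ^ (n - (k : ℕ))
        * Real.sin (polar Ω / 2) ^ (k : ℕ) : ℝ) : ℂ)
      * Complex.exp (Complex.I * ((k : ℕ) : ℂ) * (azimuth Ω : ℂ))

/-- The `N` spin coherent state `|Ω₁⟩ ⊗ … ⊗ |Ω_N⟩`. -/
def coherentState {N : ℕ} (n : ℕ) (Ω : PhaseSpace N) : HilbertSpace N n :=
  pureTensor fun i => coherent n (Ω i)

/-- The surface measure `dΩ` of the unit sphere, of total mass `4π`. -/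
def surface : Measure Sphere2 := (volume : Measure (EuclideanSpace ℝ (Fin 3))).toSphere

instance : IsFiniteMeasure surface := inferInstanceAs (IsFiniteMeasure (Measure.toSphere _))

/-- The measure `((2s+1)/(4π))^N dΩ₁ ⋯ dΩ_N` on the phase space. -/
def phaseMeasure (N n : ℕ) : Measure (PhaseSpace N) :=
  ENNReal.ofReal ((((n : ℝ) + 1) / (4 * Real.pi)) ^ N) • Measure.pi fun _ => surface

instance (N n : ℕ) : IsFiniteMeasure (phaseMeasure N n) :=
  Measure.smul_finite _ ENNReal.ofReal_ne_top

/-- The projection `|Ω⟩⟨Ω|`. -/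
def coherentProj {N : ℕ} (n : ℕ) (Ω : PhaseSpace N) : HilbertSpace N n →L[ℂ] HilbertSpace N n :=
  InnerProductSpace.rankOne ℂ (coherentState n Ω) (coherentState n Ω)

/-- The operator `A(F) = ∫ F(Ω) |Ω⟩⟨Ω|` integrated over the phase space, for a real `F`. -/
def contravariantOp {N n : ℕ} (F : Lp ℝ ∞ (phaseMeasure N n)) :
    HilbertSpace N n →L[ℂ] HilbertSpace N n :=
  ∫ Ω, F Ω • coherentProj n Ω ∂(phaseMeasure N n)

lemma norm_coherent (n : ℕ) (Ω : Sphere2) : ‖coherent n Ω‖ = 1 := by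
  have key : ∑ k : Fin (n + 1), ‖coherent n Ω k‖ ^ 2 = 1 := by
    have h1 : ∀ k : Fin (n + 1), ‖coherent n Ω k‖ ^ 2
        = (Real.sin (polar Ω / 2) ^ 2) ^ (k : ℕ) * (Real.cos (polar Ω / 2) ^ 2) ^ (n - (k : ℕ))
          * (n.choose k : ℝ) := by
      intro k
      have he : ‖Complex.exp (Complex.I * ((k : ℕ) : ℂ) * (azimuth Ω : ℂ))‖ = 1 := by
        have := Complex.norm_exp_ofReal_mul_I ((k : ℕ) * azimuth Ω)
        rw [← this]; congr 2; push_cast; ring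
      have hk : (k : ℕ) ≤ n := Nat.lt_succ_iff.mp k.2
      simp only [coherent, norm_mul, he, mul_one, Complex.norm_real, Real.norm_eq_abs, mul_pow,
        sq_abs]
      rw [Real.sq_sqrt (Nat.cast_nonneg _), Nat.choose_symm hk]
      ring
    simp_rw [h1]
    rw [Fin.sum_univ_eq_sum_range (fun k => (Real.sin (polar Ω / 2) ^ 2) ^ k
      * (Real.cos (polar Ω / 2) ^ 2) ^ (n - k) * (n.choose k : ℝ)) (n + 1), ← add_pow,
      Real.sin_sq_add_cos_sq, one_pow]
  rw [EuclideanSpace.norm_eq, key, Real.sqrt_one]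

/-- The coherent states are unit vectors. -/
lemma norm_coherentState {N : ℕ} (n : ℕ) (Ω : PhaseSpace N) : ‖coherentState n Ω‖ = 1 := by
  have key : ∑ m : Fin N → Fin (n + 1), ‖coherentState n Ω m‖ ^ 2 = 1 := by
    simp only [coherentState, pureTensor, norm_prod, ← Finset.prod_pow]
    rw [← Fintype.prod_sum (fun i k => ‖coherent n (Ω i) k‖ ^ 2)]
    refine Finset.prod_eq_one fun i _ => ?_
    rw [← EuclideanSpace.norm_sq_eq, norm_coherent, one_pow]
  rw [EuclideanSpace.norm_eq, key, Real.sqrt_one]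

lemma measurable_coherentState {N : ℕ} (n : ℕ) :
    Measurable (coherentState n : PhaseSpace N → HilbertSpace N n) := by
  have h0 : ∀ j : Fin 3, Measurable fun Ω : Sphere2 => Ω.1 j := fun j => by
    have : Continuous fun Ω : Sphere2 => Ω.1 j := by fun_prop
    exact this.measurable
  have hp : Measurable polar := Real.continuous_arccos.measurable.comp (h0 2)
  have ha : Measurable azimuth := by
    refine Complex.measurable_arg.comp ?_
    have : Measurable fun Ω : Sphere2 => ((Ω.1 0 : ℝ) : ℂ) + ((Ω.1 1 : ℝ) : ℂ) * Complex.I := by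
      have := h0 0
      have := h0 1
      fun_prop
    convert this using 2 with Ω
    exact Complex.mk_eq_add_mul_I _ _
  have hc : ∀ k, Measurable fun Ω => coherent n Ω k := by
    intro k
    simp only [coherent]
    fun_prop
  have hm : Measurable fun (Ω : PhaseSpace N) (m : Fin N → Fin (n + 1)) =>
      ∏ i, coherent n (Ω i) (m i) := by
    refine measurable_pi_lambda _ fun m => ?_
    refine Finset.measurable_prod _ fun i _ => ?_
    exact (hc (m i)).comp (measurable_pi_apply i)
  exact (PiLp.continuous_toLp 2 _).measurable.comp hm

/-- The integrand of `contravariantOp` is integrable. -/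
lemma integrable_smul_coherentProj {N n : ℕ} (F : Lp ℝ ∞ (phaseMeasure N n)) :
    Integrable (fun Ω => F Ω • coherentProj n Ω) (phaseMeasure N n) := by
  have hF : Integrable (fun Ω => F Ω) (phaseMeasure N n) := (Lp.memLp F).integrable le_top
  have hc : AEStronglyMeasurable (fun Ω => coherentProj n Ω) (phaseMeasure N n) := by
    have hcont : Continuous fun v : HilbertSpace N n => InnerProductSpace.rankOne ℂ v v := by
      simp only [InnerProductSpace.rankOne_def]
      exact ((ContinuousLinearMap.smulRightL ℂ (HilbertSpace N n) (HilbertSpace N n)).continuous.comp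
        (innerSL ℂ).continuous).clm_apply continuous_id
    exact (hcont.measurable.comp (measurable_coherentState n)).aestronglyMeasurable
  refine hF.smul_bdd 1 hc (Filter.Eventually.of_forall fun Ω => ?_)
  simp [coherentProj, norm_coherentState]

/-- `A(F)` is the compression of the multiplication by `F` along `φ ↦ (Ω ↦ ⟨Ω|φ⟩)`. -/
lemma inner_contravariantOp {N n : ℕ} (F : Lp ℝ ∞ (phaseMeasure N n)) (φ ψ : HilbertSpace N n) :
    inner ℂ φ (contravariantOp F ψ) =
      ∫ Ω, star (inner ℂ (coherentState n Ω) φ) * ((F Ω : ℂ) * inner ℂ (coherentState n Ω) ψ)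
        ∂(phaseMeasure N n) := by
  have hint := integrable_smul_coherentProj F
  unfold contravariantOp
  rw [ContinuousLinearMap.integral_apply hint, ← integral_inner (hint.apply_continuousLinearMap ψ)]
  congr 1
  funext Ω
  have e : (F Ω • coherentProj n Ω) ψ = (F Ω : ℂ) • coherentProj n Ω ψ := rfl
  rw [e, inner_smul_right, coherentProj, InnerProductSpace.inner_right_rankOne_apply,
    ← inner_conj_symm φ]
  simp only [Complex.star_def]
  ring

lemma isSelfAdjoint_contravariantOp {N n : ℕ} (F : Lp ℝ ∞ (phaseMeasure N n)) :
    IsSelfAdjoint (contravariantOp F) := by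
  have hs : StarModule ℝ (HilbertSpace N n →L[ℂ] HilbertSpace N n) := ⟨fun r B => by
    have e : ∀ C : HilbertSpace N n →L[ℂ] HilbertSpace N n, r • C = (r : ℂ) • C := fun C => rfl
    rw [star_trivial r, e, e, star_smul, Complex.star_def, Complex.conj_ofReal]⟩
  let L : (HilbertSpace N n →L[ℂ] HilbertSpace N n) ≃L[ℝ]
    (HilbertSpace N n →L[ℂ] HilbertSpace N n) := starL' ℝ
  have h : L (contravariantOp F) = contravariantOp F := by
    unfold contravariantOp
    rw [← L.integral_comp_comm]
    congr 1
    funext Ω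
    change star (F Ω • coherentProj n Ω) = _
    rw [star_smul, star_trivial]
    congr 1
    exact InnerProductSpace.adjoint_rankOne _ _
  exact h

/-- The contravariant-matrix map `F ↦ A(F)`, from the real `L^∞` functions on the phase space
to the Hermitian operators on the Hilbert space of `N` spins. -/
def contravariantMap (N n : ℕ) :
    Lp ℝ ∞ (phaseMeasure N n) → selfAdjoint (HilbertSpace N n →L[ℂ] HilbertSpace N n) :=
  fun F => ⟨contravariantOp F, isSelfAdjoint_contravariantOp F⟩

end SpinCoherent

end

noncomputable section

namespace SpinCoherent

/-! The proof is by duality. If a Hermitian `B` were missed, some real functional `f` would kill the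
range but not `B`. Testing with the bounded function `F Ω = f (|Ω⟩⟨Ω|)` gives `f (A(F)) = ∫ F² = 0`,
so `f` vanishes on almost all coherent projections (`ae_map_coherentProj_eq_zero`). Symmetrising and
complexifying `f` gives a complex functional `ψ` with the same property. In stereographic
coordinates `ψ (|Ω⟩⟨Ω|)` is a nonzero factor times a polynomial in `w` and its conjugate, whose
coefficients are nonzero multiples of the values of `ψ` on the matrix units. By continuity the
polynomial vanishes everywhere, so all these values are zero
(`eq_zero_of_ae_map_coherentProj_eq_zero`), and `f B = 0` follows. -/

/-! ### Polynomials in variables and their conjugates -/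

/-- A polynomial in complex variables and their conjugates which vanishes identically is zero. -/
lemma eq_zero_of_eval_conj_eq_zero {ι : Type*} (p : MvPolynomial (ι ⊕ ι) ℂ)
    (h : ∀ w : ι → ℂ, MvPolynomial.eval (Sum.elim w fun i => star (w i)) p = 0) : p = 0 := by
  have hinf : (Set.range ((↑) : ℝ → ℂ)).Infinite :=
    Set.infinite_range_of_injective Complex.ofReal_injective
  -- The substitution `w = x + iy`, `w̄ = x - iy`: the hypothesis says that the new polynomial
  -- vanishes at all real `x, y`, an infinite set in each variable.
  let g : ι ⊕ ι → MvPolynomial (ι ⊕ ι) ℂ :=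
    Sum.elim (fun i => .X (.inl i) + .C Complex.I * .X (.inr i))
      fun i => .X (.inl i) - .C Complex.I * .X (.inr i)
  have hg : ∀ x, MvPolynomial.eval x (MvPolynomial.bind₁ g p)
      = MvPolynomial.eval (fun j => MvPolynomial.eval x (g j)) p := fun x => by
    simpa using MvPolynomial.eval₂Hom_bind₁ (RingHom.id ℂ) x g p
  have h0 : MvPolynomial.bind₁ g p = 0 := by
    refine MvPolynomial.funext_set (fun _ => Set.range ((↑) : ℝ → ℂ)) (fun _ => hinf) fun x hx => ?_
    choose y hy using fun j => hx j (Set.mem_univ j)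
    rw [hg, map_zero, ← h fun i => y (.inl i) + Complex.I * y (.inr i)]
    congr 2
    funext j
    rcases j with i | i <;> simp [g, ← hy, sub_eq_add_neg]
  refine MvPolynomial.funext fun u => ?_
  -- The inverse linear substitution: every point `u` is reached once `x` and `y` may be complex.
  have := hg (Sum.elim (fun i => (u (.inl i) + u (.inr i)) / 2)
    fun i => (u (.inl i) - u (.inr i)) / (2 * Complex.I))
  rw [h0, map_zero] at this
  rw [map_zero, this]
  congr 2
  funext j
  have hI := Complex.I_ne_zero
  rcases j with i | i <;> simp [g] <;> field_simp <;> ring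

/-- The products of monomials in complex variables and in their conjugates are linearly
independent. -/
lemma coeff_eq_zero_of_sum_monomial_conj_eq_zero {N d : ℕ}
    (c : (Fin N → Fin d) → (Fin N → Fin d) → ℂ)
    (h : ∀ w : Fin N → ℂ,
      ∑ k, ∑ l, c k l * ((∏ i, w i ^ (k i : ℕ)) * ∏ i, star (w i) ^ (l i : ℕ)) = 0)
    (k l : Fin N → Fin d) : c k l = 0 := by
  let e : (Fin N → Fin d) × (Fin N → Fin d) → (Fin N ⊕ Fin N →₀ ℕ) := fun q =>
    Finsupp.equivFunOnFinite.symm (Sum.elim (fun i => (q.1 i : ℕ)) fun i => (q.2 i : ℕ))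
  have he : Function.Injective e := fun q r hqr => by
    have := Finsupp.equivFunOnFinite.symm.injective hqr
    ext i
    · simpa using congrFun this (.inl i)
    · simpa using congrFun this (.inr i)
  have hp : ∑ q, MvPolynomial.monomial (e q) (c q.1 q.2) = 0 := by
    refine eq_zero_of_eval_conj_eq_zero _ fun w => ?_
    rw [← h w, map_sum, ← Fintype.sum_prod_type']
    refine Finset.sum_congr rfl fun q _ => ?_
    simp [e, MvPolynomial.eval_monomial, Finsupp.prod_fintype]
  have := congrArg (MvPolynomial.coeff (e (k, l))) hp
  simpa [MvPolynomial.coeff_sum, MvPolynomial.coeff_monomial, he.eq_iff] using this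

/-! ### Stereographic coordinates -/

/-- The stereographic coordinate `tan (θ / 2) e^{iφ}` of a point of the sphere. -/
def stereo (Ω : Sphere2) : ℂ := ⟨Ω.1 0, Ω.1 1⟩ / ((1 + Ω.1 2 : ℝ) : ℂ)

lemma sum_sq_eq_one (Ω : Sphere2) : Ω.1 0 ^ 2 + Ω.1 1 ^ 2 + Ω.1 2 ^ 2 = 1 := by
  have h := EuclideanSpace.norm_sq_eq Ω.1
  rw [norm_eq_of_mem_sphere Ω, Fin.sum_univ_three] at h
  simpa using h.symm

lemma cos_polar (Ω : Sphere2) : Real.cos (polar Ω) = Ω.1 2 := by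
  have h := sum_sq_eq_one Ω
  exact Real.cos_arccos (by nlinarith [sq_nonneg (Ω.1 0), sq_nonneg (Ω.1 1)])
    (by nlinarith [sq_nonneg (Ω.1 0), sq_nonneg (Ω.1 1)])

lemma one_add_eq_cos_sq (Ω : Sphere2) : 1 + Ω.1 2 = 2 * Real.cos (polar Ω / 2) ^ 2 := by
  rw [Real.cos_sq, mul_div_cancel₀ _ two_ne_zero, cos_polar]
  ring

/-- This is the polar form of `x + iy`, whose modulus is `√(1 - z²)`. At the poles both sides are
zero, so the choice of azimuth is harmless. -/
lemma sin_mul_exp_azimuth (Ω : Sphere2) :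
    (Real.sin (polar Ω) : ℂ) * Complex.exp (azimuth Ω * Complex.I) = ⟨Ω.1 0, Ω.1 1⟩ := by
  conv_rhs => rw [← Complex.norm_mul_exp_arg_mul_I ⟨Ω.1 0, Ω.1 1⟩]
  congr 2
  rw [polar, Real.sin_arccos, Complex.norm_eq_sqrt_sq_add_sq]
  congr 1
  linarith [sum_sq_eq_one Ω]

lemma cos_half_polar_ne_zero {Ω : Sphere2} (h : 1 + Ω.1 2 ≠ 0) : Real.cos (polar Ω / 2) ≠ 0 :=
  fun h0 => h (by rw [one_add_eq_cos_sq, h0]; ring)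

lemma cos_mul_stereo {Ω : Sphere2} (h : 1 + Ω.1 2 ≠ 0) :
    (Real.cos (polar Ω / 2) : ℂ) * stereo Ω
      = Real.sin (polar Ω / 2) * Complex.exp (azimuth Ω * Complex.I) := by
  have hc : (Real.cos (polar Ω / 2) : ℂ) ≠ 0 := by exact_mod_cast cos_half_polar_ne_zero h
  have hs : Real.sin (polar Ω) = 2 * Real.sin (polar Ω / 2) * Real.cos (polar Ω / 2) := by
    rw [← Real.sin_two_mul, mul_div_cancel₀ _ two_ne_zero]
  rw [stereo, ← sin_mul_exp_azimuth, one_add_eq_cos_sq, hs]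
  push_cast at hc ⊢
  field_simp

/-- Away from the south pole, the coherent state is a multiple of the vector of monomials in the
stereographic coordinate. -/
lemma coherent_eq_stereo_pow (n : ℕ) {Ω : Sphere2} (h : 1 + Ω.1 2 ≠ 0) (k : Fin (n + 1)) :
    coherent n Ω k = (Real.sqrt (n.choose (n - k)) : ℂ) * (Real.cos (polar Ω / 2) : ℂ) ^ n
      * stereo Ω ^ (k : ℕ) := by
  have hk : n = (n - (k : ℕ)) + k := (Nat.sub_add_cancel (Nat.lt_succ_iff.mp k.2)).symm
  have he : Complex.exp (Complex.I * ((k : ℕ) : ℂ) * (azimuth Ω : ℂ))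
      = Complex.exp (azimuth Ω * Complex.I) ^ (k : ℕ) := by
    rw [← Complex.exp_nat_mul]; congr 1; ring
  have hp : (Real.cos (polar Ω / 2) : ℂ) ^ n * stereo Ω ^ (k : ℕ)
      = (Real.cos (polar Ω / 2) : ℂ) ^ (n - (k : ℕ)) *
        (Real.sin (polar Ω / 2) * Complex.exp (azimuth Ω * Complex.I)) ^ (k : ℕ) := by
    rw [← cos_mul_stereo h, mul_pow, ← mul_assoc, ← pow_add, ← hk]
  rw [mul_assoc, hp, coherent]
  simp only [he]
  push_cast
  ring

/-- The witness is inverse stereographic projection, with `d = 1 + |w|²` and height `(1 - |w|²) / (1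
+ |w|²)`. -/
lemma exists_stereo_eq (w : ℂ) : ∃ Ω : Sphere2, 1 + Ω.1 2 ≠ 0 ∧ stereo Ω = w := by
  have hd : 1 + w.re ^ 2 + w.im ^ 2 ≠ 0 := by positivity
  set d := 1 + w.re ^ 2 + w.im ^ 2 with hdef
  refine ⟨⟨!₂[2 * w.re / d, 2 * w.im / d, (2 - d) / d], ?_⟩, ?_, ?_⟩
  · rw [mem_sphere_zero_iff_norm, EuclideanSpace.norm_eq, Real.sqrt_eq_one]
    simp only [Fin.sum_univ_three, Real.norm_eq_abs, sq_abs]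
    simp
    field_simp
    rw [hdef]
    ring
  · simp
    field_simp
    norm_num
  · have h2 : (1 + (2 - d) / d : ℝ) = 2 / d := by field_simp; ring
    simp only [stereo]
    simp only [Matrix.cons_val]
    rw [h2, div_eq_iff (by simpa using hd)]
    apply Complex.ext <;> simp <;> field_simp

lemma continuousOn_stereo : ContinuousOn stereo {Ω : Sphere2 | 1 + Ω.1 2 ≠ 0} := by
  have hn : Continuous fun Ω : Sphere2 => (⟨Ω.1 0, Ω.1 1⟩ : ℂ) := by
    simp only [Complex.mk_eq_add_mul_I]
    fun_prop
  have hd : Continuous fun Ω : Sphere2 => ((1 + Ω.1 2 : ℝ) : ℂ) := by fun_prop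
  exact hn.continuousOn.div hd.continuousOn fun Ω hΩ =>
    Complex.ofReal_ne_zero.mpr hΩ

/-! ### Functionals vanishing on coherent projections -/

instance : surface.IsOpenPosMeasure := inferInstanceAs (Measure.toSphere _).IsOpenPosMeasure

/-- Positivity on open sets upgrades almost everywhere vanishing of a continuous function to
vanishing everywhere. -/
instance (N n : ℕ) : (phaseMeasure N n).IsOpenPosMeasure where
  open_pos U hU hne := by
    have h0 : ENNReal.ofReal ((((n : ℝ) + 1) / (4 * Real.pi)) ^ N) ≠ 0 := by
      rw [ne_eq, ENNReal.ofReal_eq_zero, not_le]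
      positivity
    rw [phaseMeasure, Measure.smul_apply, smul_eq_mul]
    have : (Measure.pi fun _ : Fin N => surface).IsOpenPosMeasure :=
      Measure.pi.isOpenPosMeasure _
    exact mul_ne_zero h0 (hU.measure_ne_zero _ hne)

/-- The expansion of a complex linear functional on the coherent projections. -/
lemma map_coherentProj_eq_sum {N n : ℕ}
    (ψ : (HilbertSpace N n →L[ℂ] HilbertSpace N n) →ₗ[ℂ] ℂ) (Ω : PhaseSpace N) :
    ψ (coherentProj n Ω) = ∑ k, ∑ l, coherentState n Ω k * star (coherentState n Ω l) *
      ψ (InnerProductSpace.rankOne ℂ (EuclideanSpace.basisFun _ ℂ k)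
        (EuclideanSpace.basisFun _ ℂ l)) := by
  have h := (EuclideanSpace.basisFun (Fin N → Fin (n + 1)) ℂ).sum_repr (coherentState n Ω)
  rw [coherentProj]
  conv_lhs => rw [← h]
  simp only [map_sum, sum_apply]
  rw [Finset.sum_comm]
  simp [mul_assoc]

lemma prod_sqrt_choose_ne_zero {N n : ℕ} (k : Fin N → Fin (n + 1)) :
    (∏ i, (Real.sqrt (n.choose (n - k i)) : ℂ)) ≠ 0 := by
  refine Finset.prod_ne_zero_iff.mpr fun i _ => ?_
  have := Nat.choose_pos (Nat.sub_le n (k i))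
  exact_mod_cast (Real.sqrt_pos.mpr (by exact_mod_cast this)).ne'

/-- The coherent projections separate the complex linear functionals, even up to null sets. -/
lemma eq_zero_of_ae_map_coherentProj_eq_zero {N n : ℕ}
    (ψ : (HilbertSpace N n →L[ℂ] HilbertSpace N n) →ₗ[ℂ] ℂ)
    (h : ∀ᵐ Ω ∂phaseMeasure N n, ψ (coherentProj n Ω) = 0) : ψ = 0 := by
  let b := EuclideanSpace.basisFun (Fin N → Fin (n + 1)) ℂ
  let a : (Fin N → Fin (n + 1)) → ℂ := fun k => ∏ i, (Real.sqrt (n.choose (n - k i)) : ℂ)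
  let c : (Fin N → Fin (n + 1)) → (Fin N → Fin (n + 1)) → ℂ := fun k l =>
    a k * star (a l) * ψ (InnerProductSpace.rankOne ℂ (b k) (b l))
  let P : (Fin N → ℂ) → ℂ := fun w =>
    ∑ k, ∑ l, c k l * ((∏ i, w i ^ (k i : ℕ)) * ∏ i, star (w i) ^ (l i : ℕ))
  -- No component is at the south pole. Whether `U` has full measure is irrelevant: its
  -- stereographic image is already all of `ℂ^N`.
  let U : Set (PhaseSpace N) := {Ω | ∀ i, 1 + (Ω i).1 2 ≠ 0}
  have hU : IsOpen U := by
    have : U = ⋂ i, {Ω | 1 + (Ω i).1 2 ≠ 0} := by ext; simp [U]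
    rw [this]
    exact isOpen_iInter_of_finite fun i => isOpen_ne_fun (by fun_prop) continuous_const
  have hP : Continuous P := by fun_prop
  have hst : ContinuousOn (fun (Ω : PhaseSpace N) i => stereo (Ω i)) U :=
    continuousOn_pi.mpr fun i => continuousOn_stereo.comp (continuous_apply i).continuousOn
      fun Ω hΩ => hΩ i
  have hv : ∀ Ω ∈ U, ∀ k, coherentState n Ω k
      = (∏ i, (Real.cos (polar (Ω i) / 2) : ℂ) ^ n) * a k * ∏ i, stereo (Ω i) ^ (k i : ℕ) := by
    intro Ω hΩ k
    simp only [coherentState, pureTensor, a, ← Finset.prod_mul_distrib]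
    refine Finset.prod_congr rfl fun i _ => ?_
    rw [coherent_eq_stereo_pow n (hΩ i)]
    ring
  have hψ : ∀ Ω ∈ U, ψ (coherentProj n Ω) = (∏ i, (Real.cos (polar (Ω i) / 2) : ℂ) ^ n)
      * star (∏ i, (Real.cos (polar (Ω i) / 2) : ℂ) ^ n) * P fun i => stereo (Ω i) := by
    intro Ω hΩ
    rw [map_coherentProj_eq_sum]
    simp only [P, c, Finset.mul_sum]
    refine Finset.sum_congr rfl fun k _ => Finset.sum_congr rfl fun l _ => ?_
    rw [hv Ω hΩ, hv Ω hΩ]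
    simp only [star_mul', star_prod, star_pow, b]
    ring
  have hae : (fun Ω : PhaseSpace N => P fun i => stereo (Ω i))
      =ᵐ[(phaseMeasure N n).restrict U] fun _ => 0 := by
    filter_upwards [ae_restrict_of_ae h, ae_restrict_mem hU.measurableSet] with Ω h0 hΩ
    rw [hψ Ω hΩ] at h0
    have hc : (∏ i, (Real.cos (polar (Ω i) / 2) : ℂ) ^ n) ≠ 0 :=
      Finset.prod_ne_zero_iff.mpr fun i _ =>
        pow_ne_zero _ (by exact_mod_cast cos_half_polar_ne_zero (hΩ i))
    exact (mul_eq_zero.mp h0).resolve_left (mul_ne_zero hc (star_ne_zero.mpr hc))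
  have hzero := Measure.eqOn_open_of_ae_eq hae hU (hP.comp_continuousOn hst) continuousOn_const
  have hc := coeff_eq_zero_of_sum_monomial_conj_eq_zero c fun w => by
    choose Ω hΩ hw using fun i => exists_stereo_eq (w i)
    have := hzero (x := Ω) hΩ
    simpa only [hw] using this
  have hE : ∀ k l, ψ (InnerProductSpace.rankOne ℂ (b k) (b l)) = 0 := fun k l =>
    (mul_eq_zero.mp (hc k l)).resolve_left
      (mul_ne_zero (prod_sqrt_choose_ne_zero k) (star_ne_zero.mpr (prod_sqrt_choose_ne_zero l)))
  refine LinearMap.ext fun T => ?_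
  -- The matrix units span, so `ψ` is determined by its values on them.
  have hT : T = ∑ l, ∑ k, b.repr (T (b l)) k • InnerProductSpace.rankOne ℂ (b k) (b l) := by
    refine ContinuousLinearMap.ext fun x => ?_
    conv_lhs => rw [← b.sum_repr x, map_sum]
    rw [sum_apply]
    refine Finset.sum_congr rfl fun l _ => ?_
    rw [map_smul, sum_apply]
    conv_lhs => rw [← b.sum_repr (T (b l)), Finset.smul_sum]
    refine Finset.sum_congr rfl fun k _ => ?_
    rw [smul_apply, InnerProductSpace.rankOne_apply, b.repr_apply_apply x,
      smul_comm]
  rw [hT]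
  simp [map_sum, hE]

lemma star_coherentProj {N : ℕ} (n : ℕ) (Ω : PhaseSpace N) :
    star (coherentProj n Ω) = coherentProj n Ω :=
  InnerProductSpace.adjoint_rankOne _ _

/-- A real linear functional which vanishes on almost all coherent projections vanishes on the
Hermitian operators. -/
lemma map_eq_zero_of_ae_map_coherentProj_eq_zero {N n : ℕ}
    (f : (HilbertSpace N n →L[ℂ] HilbertSpace N n) →ₗ[ℝ] ℝ)
    (h : ∀ᵐ Ω ∂phaseMeasure N n, f (coherentProj n Ω) = 0)
    {B : HilbertSpace N n →L[ℂ] HilbertSpace N n} (hB : star B = B) : f B = 0 := by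
  have hs : ∀ (r : ℝ) (T : HilbertSpace N n →L[ℂ] HilbertSpace N n), star (r • T) = r • star T := by
    intro r T
    have e : ∀ C : HilbertSpace N n →L[ℂ] HilbertSpace N n, r • C = (r : ℂ) • C := fun C => rfl
    rw [e, e, star_smul, Complex.star_def, Complex.conj_ofReal]
  -- Complexifying `f` directly would involve the unknown values `f (i|Ω⟩⟨Ω|)`. Symmetrising removes
  -- them, since `i|Ω⟩⟨Ω|` is anti-Hermitian.
  let g : Module.Dual ℝ (HilbertSpace N n →L[ℂ] HilbertSpace N n) :=
    { toFun := fun T => f (T + star T)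
      map_add' := fun S T => by
        have h : star (S + T) = star S + star T := star_add S T
        rw [← map_add, h]
        congr 1
        abel
      map_smul' := fun r T => by rw [hs, ← smul_add, map_smul]; rfl }
  have hg : ∀ T, g T = f (T + star T) := fun _ => rfl
  have h0 : (g.extendRCLike : Module.Dual ℂ _) = 0 := by
    refine eq_zero_of_ae_map_coherentProj_eq_zero _ ?_
    filter_upwards [h] with Ω hΩ
    rw [Module.Dual.extendRCLike_apply, hg, hg, star_smul, star_coherentProj, map_add, hΩ]
    simp
  have := Module.Dual.re_extendRCLike_apply (𝕜 := ℂ) g B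
  rw [h0, hg, hB, map_add] at this
  simp at this
  linarith

/-! ### The range and its annihilator -/

/-- The range of the contravariant-matrix map, as a real subspace. -/
def contravariantRange (N n : ℕ) : Submodule ℝ (HilbertSpace N n →L[ℂ] HilbertSpace N n) where
  carrier := Set.range (contravariantOp (N := N) (n := n))
  zero_mem' := ⟨0, by
    unfold contravariantOp
    refine integral_eq_zero_of_ae ?_
    filter_upwards [Lp.coeFn_zero ℝ ∞ (phaseMeasure N n)] with Ω hΩ
    rw [hΩ]
    exact zero_smul ℝ (coherentProj n Ω)⟩
  add_mem' := by
    rintro _ _ ⟨F, rfl⟩ ⟨G, rfl⟩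
    refine ⟨F + G, ?_⟩
    unfold contravariantOp
    rw [← integral_add (integrable_smul_coherentProj F) (integrable_smul_coherentProj G)]
    refine integral_congr_ae ?_
    filter_upwards [Lp.coeFn_add F G] with Ω hΩ
    rw [hΩ]
    exact add_smul (F Ω) (G Ω) (coherentProj n Ω)
  smul_mem' := by
    rintro r _ ⟨F, rfl⟩
    refine ⟨r • F, ?_⟩
    unfold contravariantOp
    rw [← integral_smul]
    refine integral_congr_ae ?_
    filter_upwards [Lp.coeFn_smul r F] with Ω hΩ
    rw [hΩ, Pi.smul_apply, smul_eq_mul, mul_smul]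

lemma stronglyMeasurable_coherentProj {N : ℕ} (n : ℕ) :
    StronglyMeasurable (coherentProj n : PhaseSpace N → _) := by
  have hcont : Continuous fun v : HilbertSpace N n => InnerProductSpace.rankOne ℂ v v := by
    simp only [InnerProductSpace.rankOne_def]
    exact ((ContinuousLinearMap.smulRightL ℂ (HilbertSpace N n) (HilbertSpace N n)).continuous.comp
      (innerSL ℂ).continuous).clm_apply continuous_id
  exact hcont.comp_stronglyMeasurable (measurable_coherentState n).stronglyMeasurable

/-- A real linear functional which annihilates the range of the contravariant-matrix map vanishes
on almost all coherent projections. -/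
lemma ae_map_coherentProj_eq_zero {N n : ℕ}
    (f : (HilbertSpace N n →L[ℂ] HilbertSpace N n) →ₗ[ℝ] ℝ)
    (hf : ∀ F, f (contravariantOp F) = 0) :
    ∀ᵐ Ω ∂phaseMeasure N n, f (coherentProj n Ω) = 0 := by
  have : FiniteDimensional ℝ (HilbertSpace N n →L[ℂ] HilbertSpace N n) :=
    FiniteDimensional.complexToReal _
  let L : (HilbertSpace N n →L[ℂ] HilbertSpace N n) →L[ℝ] ℝ := LinearMap.toContinuousLinearMap f
  have hL : ∀ T, L T = f T := fun _ => rfl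
  have hmem : MemLp (fun Ω => L (coherentProj n Ω)) ∞ (phaseMeasure N n) := by
    refine memLp_top_of_bound
      (L.continuous.comp_stronglyMeasurable (stronglyMeasurable_coherentProj n)).aestronglyMeasurable
      ‖L‖ (Filter.Eventually.of_forall fun Ω => ?_)
    refine (L.le_opNorm _).trans_eq ?_
    simp [coherentProj, norm_coherentState]
  -- The functional's own values on the projections serve as test function, which makes the
  -- integrand a square.
  have h0 := hf (hmem.toLp _)
  have hint := integrable_smul_coherentProj (hmem.toLp _)
  rw [← hL, contravariantOp, ← L.integral_comp_comm hint] at h0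
  have hsq : (fun Ω => L ((hmem.toLp _) Ω • coherentProj n Ω)) =ᵐ[phaseMeasure N n]
      fun Ω => L (coherentProj n Ω) * L (coherentProj n Ω) := by
    filter_upwards [hmem.coeFn_toLp] with Ω hΩ
    rw [map_smul, hΩ, smul_eq_mul]
  have hi := (L.integrable_comp hint).congr hsq
  rw [integral_congr_ae hsq, integral_eq_zero_iff_of_nonneg (fun Ω => mul_self_nonneg _) hi] at h0
  filter_upwards [h0] with Ω hΩ
  exact mul_self_eq_zero.mp hΩ

end SpinCoherent

end

theorem proposition5p3 (N n : ℕ) :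
    Function.Surjective (SpinCoherent.contravariantMap N n) := by
  rintro ⟨B, hB⟩
  by_cases hmem : B ∈ SpinCoherent.contravariantRange N n
  · obtain ⟨F, hF⟩ := hmem
    exact ⟨F, Subtype.ext hF⟩
  · obtain ⟨f, hfB, hf⟩ := Submodule.exists_le_ker_of_notMem hmem
    exact absurd (SpinCoherent.map_eq_zero_of_ae_map_coherentProj_eq_zero f
      (SpinCoherent.ae_map_coherentProj_eq_zero f fun F => hf ⟨F, rfl⟩) hB) hfB
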